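/- Let $n\ge 1$. Let $\mathsf{Path}(n)$ be the path on $[n]=\{1,\dots,n\}$ with edges $\{i,i+1\}$, and let $\mathcal B$ be the collection of nonempty subsets of $[n]$ inducing a connected subgraph (the nonempty intervals). The associahedron is the polytope $$P=\sum_{I\in\mathcal B}y_I\,\mathrm{conv}\{e_i: i\in I\}\subset\mathbb R^n ,$$ a Minkowski sum with arbitrary parameters $y_I>0$. The normal cone of a face $F$ of $P$ is the set of $x\in(\mathbb R^n)^*\cong\mathbb R^n$ whose maximum on $P$ is attained at all points of $F$. For a full-dimensional normal cone $\sigma$, let $Q_\sigma$ be the poset on $[n]$ with $i\le_{Q_\sigma} j$ iff $x_i\le x_j$ for all $x\in\sigma$. For a poset $Q$ on $[n]$ put $\mathrm{Des}(Q)=\{(i,j): i\lessdot_Q j,\ i>j \text{ in } \mathbb N\}$ and $\mathrm{des}(Q)=|\mathrm{Des}(Q)|$. If $Q$ is graded, i.e. if there are rank functions $\rho:Q\to\mathbb N$ (functions with $\rho(j)=\rho(i)+1$ whenever $i\lessdot_Q j$), put $\mathrm{maj}(Q)=\sum_{(i,j)\in\mathrm{Des}(Q)}\rho(j)$ with $\rho$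 the minimal rank function. The $q$-$h$-polynomial of $P$ is $$h_{\mathsf{Path}(n)}(t,q)=\sum_{\sigma}t^{\mathrm{des}(Q_\sigma)}q^{\mathrm{maj}(Q_\sigma)},$$ the sum over all full-dimensional normal cones $\sigma$ of $P$. For a rooted (unlabeled, plane) binary tree $T$, in which every child is either a left or a right child, let $\mathrm{depth}(T)$ be the maximal distance of a vertex of $T$ from the root. For an edge $e$ let $\mathrm{dp}(e)$ be the distance from the root to the endpoint of $e$ closer to the root. Let $\mathcal R(T)$ be the multiset of all $\mathrm{dp}(e)$ with $e$ a right edge of $T$ (an edge from a vertex to its right child). Put $r(T)=|\mathcal R(T)|$ and $$\mathrm{rindex}(T)=\mathrm{depth}(T)\,r(T)-\sum_{j\in\mathcal R(T)}j .$$ Then there are finitely many full-dimensional normal cones $\sigma$ of $P$, every $Q_\sigma$ is graded and has a least rank function (so that $h_{\mathsf{Path}(n)}$ is well defined), and $$h_{\mathsf{Path}(n)}(t,q)=\sum_{T}t^{r(T)}q^{\mathrm{rindex}(T)},$$ where $T$ ranges over all binary trees on $n$ vertices. Consequently, with the (alternative) $q$-Narayana numbers $$N(n,k,q)=\sum_{T:\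 r(T)=k-1}q^{\mathrm{rindex}(T)}\qquad(1\le k\le n),$$ one has $h_{\mathsf{Path}(n)}(t,q)=\sum_{k=1}^nN(n,k,q)\,t^{k-1}$, and $N(n,k,1)=\frac1n\binom nk\binom n{k-1}$ is the Narayana number. -/

import Mathlib

open Polynomial
open scoped Pointwise

noncomputable section

namespace QAssoc

/-! ### Posets on `[n]`: descents, rank, major index

The ground set `[n]` is modelled by `Fin n`; only the natural order of the labels matters, and it is
always expressed in `ℕ` in order to distinguish it from the order of the poset. -/

/-- `i ⋖_Q j` in the poset `Q`. -/
def Covers {n : ℕ} (Q : PartialOrder (Fin n)) (i j : Fin n) : Prop :=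
  @CovBy (Fin n) Q.toLT i j

open Classical in
/-- `Des(Q)`: the pairs `(i, j)` with `i ⋖_Q j` and `i > j` as natural numbers. -/
def posetDescents {n : ℕ} (Q : PartialOrder (Fin n)) : Finset (Fin n × Fin n) :=
  Finset.univ.filter fun p => Covers Q p.1 p.2 ∧ (p.2 : ℕ) < (p.1 : ℕ)

/-- `des(Q)`. -/
def posetDes {n : ℕ} (Q : PartialOrder (Fin n)) : ℕ := (posetDescents Q).card

/-- `ρ` is a rank function of `Q`. The poset `Q` is graded when such a function exists. -/
def IsRankFunction {n : ℕ} (Q : PartialOrder (Fin n)) (ρ : Fin n → ℕ) : Prop :=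
  ∀ i j, Covers Q i j → ρ j = ρ i + 1

/-- The minimal rank function of a graded poset (pointwise minimum of all rank functions). -/
def minRank {n : ℕ} (Q : PartialOrder (Fin n)) (i : Fin n) : ℕ :=
  sInf {m | ∃ ρ, IsRankFunction Q ρ ∧ ρ i = m}

/-- `maj(Q) = ∑_{(i,j) ∈ Des(Q)} ρ(j)` with `ρ` the minimal rank function. -/
def posetMaj {n : ℕ} (Q : PartialOrder (Fin n)) : ℕ :=
  ∑ p ∈ posetDescents Q, minRank Q p.2

/-! ### Normal fans

Linear functionals on `ℝⁿ` are identified with vectors through the dot product. All normal cones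
live in `ℝⁿ`; for a polytope in a hyperplane `∑ xᵢ = c` they contain the line spanned by
`(1, …, 1)`, and are the preimages of the cones in `ℝⁿ / (1, …, 1)`, so that the full-dimensional
cones in the two spaces correspond to each other. -/

/-- The set of the points of `P` at which the functional `ℓ` is maximal on `P`. -/
def maxFace {n : ℕ} (P : Set (Fin n → ℝ)) (l : Fin n → ℝ) : Set (Fin n → ℝ) :=
  {x | x ∈ P ∧ ∀ y ∈ P, l ⬝ᵥ y ≤ l ⬝ᵥ x}

/-- The normal cone of `F` in `P`: the functionals whose maximum on `P` is attained at every point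
of `F`. -/
def normalCone {n : ℕ} (P F : Set (Fin n → ℝ)) : Set (Fin n → ℝ) :=
  {l | ∀ x ∈ F, ∀ y ∈ P, l ⬝ᵥ y ≤ l ⬝ᵥ x}

/-- The full-dimensional cones of the normal fan of `P`. -/
def fullCones {n : ℕ} (P : Set (Fin n → ℝ)) : Set (Set (Fin n → ℝ)) :=
  {σ | (∃ l, σ = normalCone P (maxFace P l)) ∧ Submodule.span ℝ σ = ⊤}

/-- The poset `Q_σ` of a full-dimensional cone `σ`: `i ≤ j` iff `x_i ≤ x_j` for all `x ∈ σ`. -/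
@[reducible] def conePoset {n : ℕ} (σ : Set (Fin n → ℝ)) (hσ : Submodule.span ℝ σ = ⊤) :
    PartialOrder (Fin n) where
  le i j := ∀ x ∈ σ, x i ≤ x j
  lt i j := (∀ x ∈ σ, x i ≤ x j) ∧ ¬ ∀ x ∈ σ, x j ≤ x i
  lt_iff_le_not_ge _ _ := Iff.rfl
  le_refl _ _ _ := le_rfl
  le_trans _ _ _ hij hjk x hx := (hij x hx).trans (hjk x hx)
  le_antisymm i j hij hji := by
    have h : ∀ x ∈ Submodule.span ℝ σ, x i = x j := by
      intro x hx
      induction hx using Submodule.span_induction with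
      | mem x hx => exact le_antisymm (hij x hx) (hji x hx)
      | zero => rfl
      | add x y _ _ hx hy => simp [hx, hy]
      | smul a x _ hx => simp [hx]
    by_contra hne
    have h1 := h (Pi.single i 1) (by rw [hσ]; trivial)
    rw [Pi.single_eq_same, Pi.single_eq_of_ne (Ne.symm hne)] at h1
    exact one_ne_zero h1

/-- The poset of a full-dimensional cone of the normal fan of `P`. -/
@[reducible] def fanPoset {n : ℕ} (P : Set (Fin n → ℝ)) (σ : fullCones P) : PartialOrder (Fin n) :=
  conePoset σ.1 σ.2.2

/-- The `q`-`h`-polynomial `h_P(t,q) = ∑_σ t^{des(Q_σ)} q^{maj(Q_σ)}` as an element of `ℤ[q][t]`: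
the outer variable is `t`, the inner one is `q`. -/
def qhPolynomial {n : ℕ} (P : Set (Fin n → ℝ)) : ℤ[X][X] :=
  ∑ᶠ σ : fullCones P, X ^ posetDes (fanPoset P σ) * C (X ^ posetMaj (fanPoset P σ))

/-! ### Nestohedra and graph associahedra -/

/-- `Δ_I = conv {e_i : i ∈ I}`. -/
def simplexOf {n : ℕ} (I : Finset (Fin n)) : Set (Fin n → ℝ) :=
  convexHull ℝ ((fun i => (Pi.single i 1 : Fin n → ℝ)) '' (I : Set (Fin n)))

/-- The Minkowski sum `∑_{I ∈ B} y_I Δ_I`. -/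
def nestohedron {n : ℕ} (B : Finset (Finset (Fin n))) (y : Finset (Fin n) → ℝ) :
    Set (Fin n → ℝ) :=
  ∑ I ∈ B, y I • simplexOf I

open Classical in
/-- The building set of a graph `G` on `[n]`: the nonempty vertex sets inducing a connected subgraph,
together with the whole of `[n]`. -/
def graphBuildingSet {n : ℕ} (G : SimpleGraph (Fin n)) : Finset (Finset (Fin n)) :=
  insert Finset.univ
    (Finset.univ.filter fun J => (G.induce (J : Set (Fin n))).Connected)

/-- The graph associahedron of `G`, realized as the nestohedron with parameters `y`. -/
def graphAssociahedron {n : ℕ} (G : SimpleGraph (Fin n)) (y : Finset (Fin n) → ℝ) :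
    Set (Fin n → ℝ) :=
  nestohedron (graphBuildingSet G) y

/-! ### Binary trees -/

/-- The multiset of the depths (distances from the root) of the vertices of a binary tree. -/
def vertexDepths : BinaryTree Unit → Multiset ℕ
  | .nil => 0
  | .node _ l r => 0 ::ₘ (vertexDepths l + vertexDepths r).map (· + 1)

/-- `depth(T)`: the maximal depth of a vertex. -/
def depth (T : BinaryTree Unit) : ℕ := (vertexDepths T).sup

/-- The right multiset `R(T)`: for every right edge, the distance from the root to the endpoint of
that edge that is closer to the root. -/
def rightMultiset : BinaryTree Unit → Multiset ℕ
  | .nil => 0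
  | .node _ l r =>
    (if r = .nil then 0 else {0}) + (rightMultiset l + rightMultiset r).map (· + 1)

/-- The right number `r(T)`. -/
def rightNumber (T : BinaryTree Unit) : ℕ := (rightMultiset T).card

/-- The right index `depth(T) r(T) - ∑_{j ∈ R(T)} j`; by `rightMultiset_sum_le` below the
subtraction is not truncated. -/
def rindex (T : BinaryTree Unit) : ℕ := depth T * rightNumber T - (rightMultiset T).sum

theorem exists_vertexDepths_of_mem_rightMultiset (T : BinaryTree Unit) :
    ∀ j ∈ rightMultiset T, j ∈ vertexDepths T := by
  induction T with
  | nil => simp [rightMultiset]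
  | node a l r hl hr =>
    intro j hj
    simp only [rightMultiset, vertexDepths, Multiset.mem_add, Multiset.mem_map,
      Multiset.mem_cons] at hj ⊢
    rcases hj with hj | ⟨k, hk | hk, rfl⟩
    · left
      split_ifs at hj <;> simp_all
    · exact Or.inr ⟨k, Or.inl (hl k hk), rfl⟩
    · exact Or.inr ⟨k, Or.inr (hr k hk), rfl⟩

theorem rightMultiset_sum_le (T : BinaryTree Unit) :
    (rightMultiset T).sum ≤ depth T * rightNumber T := by
  have h := Multiset.sum_le_card_nsmul (rightMultiset T) (depth T) fun j hj =>
    Multiset.le_sup (exists_vertexDepths_of_mem_rightMultiset T j hj)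
  rw [smul_eq_mul, mul_comm] at h
  exact h

/-- The alternative `q`-Narayana number: the sum of `q^{rindex(T)}` over the binary trees `T` on `n`
vertices with `r(T) = k - 1`. -/
def qNarayana (n k : ℕ) : ℤ[X] :=
  ∑ T ∈ (BinaryTree.treesOfNumNodesEq n).filter (fun T => rightNumber T + 1 = k), X ^ rindex T

end QAssoc

end

noncomputable section

namespace QAssoc

/-! ### Intervals and the positions of their minima -/

/-! A functional is maximal on a Minkowski sum exactly where it is maximal on each summand. The
normal cone of the face selected by `l` is therefore cut out by comparing, on each member of the
building set, the maximizers of `l` with the other elements. For the path the members are the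
intervals, so the cone depends only on the relation "`l` is maximal over the interval from `i` to
`j` at `j`", which is `Dominates` for `-l` (`normalCone_maxFace_path`). The cone recovers this
relation, and full dimension makes it antisymmetric. Antisymmetric relations of this kind are the
ancestor relations of binary trees in in-order (`exists_tree`, `tree_ext`): the tree is built
recursively by splitting at the unique minimum.

Hence each `Q_σ` is a tree with its root on top. Covers are parent edges, descents are right edges,
and the least rank function is the depth of the tree minus the depth of the vertex, which turns
`maj` into `rindex`.

At `q = 1`, splitting trees at the root gives a quadratic functional equation. The coefficients of
all powers of its solution are 2 × 2 minors of binomial coefficients, verified through Pascal's rule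
(`coeff_narayanaSeries_pow`). -/

/-- `f` attains its minimum over the interval spanned by `i` and `j` at `j`. -/
def Dominates {α : Type*} [LinearOrder α] (f : ℕ → α) (i j : ℕ) : Prop :=
  ∀ k, min i j ≤ k → k ≤ max i j → f j ≤ f k

namespace Dominates

variable {α β : Type*} [LinearOrder α] [LinearOrder β] {f : ℕ → α} {g : ℕ → β} {i j k : ℕ}

theorem refl (f : ℕ → α) (i : ℕ) : Dominates f i i := by
  intro k h1 h2
  have : k = i := by grind
  rw [this]

theorem le (h : Dominates f i j) : f j ≤ f i := h i (by grind) (by grind)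

theorem trans (h1 : Dominates f i j) (h2 : Dominates f j k) : Dominates f i k := by
  intro m hm1 hm2
  by_cases hm : min i j ≤ m ∧ m ≤ max i j
  · exact h2.le.trans (h1 m hm.1 hm.2)
  · exact h2 m (by grind) (by grind)

/-- Ancestors of one vertex form a chain: the interval from `j` to `k` is covered by those from `i`
to `j` and from `i` to `k`. -/
theorem of_common (h1 : Dominates f i j) (h2 : Dominates f i k) (hjk : f k ≤ f j) :
    Dominates f j k := by
  intro m hm1 hm2
  by_cases hm : min i j ≤ m ∧ m ≤ max i j
  · exact hjk.trans (h1 m hm.1 hm.2)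
  · exact h2 m (by grind) (by grind)

theorem not_of_strict_min {m p : ℕ} (hf : ∀ i < m, i ≠ p → f p < f i) (hj : j < m) (hjp : j ≠ p)
    (h1 : min i j ≤ p) (h2 : p ≤ max i j) : ¬ Dominates f i j :=
  fun h => absurd (h p h1 h2) (not_le.2 (hf j hj hjp))

theorem of_strict_min {m p : ℕ} (hf : ∀ i < m, i ≠ p → f p < f i) (hi : i < m) (hj : j < m)
    (hjp : j = p) : Dominates f i j := by
  intro k hk1 hk2
  subst hjp
  by_cases hk : k = j
  · rw [hk]
  · exact (hf k (by grind) hk).le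

/-- A strict minimum at `p` decides every pair that ends at `p` or whose interval contains `p`; only
pairs on one side of `p` carry further information. -/
theorem iff_of_strict_min {m p : ℕ}
    (hf : ∀ i < m, i ≠ p → f p < f i) (hg : ∀ i < m, i ≠ p → g p < g i)
    (hl : ∀ i < p, ∀ j < p, (Dominates f i j ↔ Dominates g i j))
    (hr : ∀ i j, p + 1 + i < m → p + 1 + j < m →
      (Dominates f (p + 1 + i) (p + 1 + j) ↔ Dominates g (p + 1 + i) (p + 1 + j)))
    (hi : i < m) (hj : j < m) : Dominates f i j ↔ Dominates g i j := by
  by_cases hjp : j = p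
  · exact iff_of_true (of_strict_min hf hi hj hjp) (of_strict_min hg hi hj hjp)
  by_cases hb : min i j ≤ p ∧ p ≤ max i j
  · exact iff_of_false (not_of_strict_min hf hj hjp hb.1 hb.2)
      (not_of_strict_min hg hj hjp hb.1 hb.2)
  by_cases hlt : max i j < p
  · exact hl i (by grind) j (by grind)
  · obtain ⟨i', rfl⟩ := Nat.exists_eq_add_of_le (show p + 1 ≤ i by grind)
    obtain ⟨j', rfl⟩ := Nat.exists_eq_add_of_le (show p + 1 ≤ j by grind)
    exact hr i' j' hi hj

theorem congr_of_le {a : ℕ} (h : ∀ k ≤ max i j, ∀ m ≤ max i j,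
    (f (a + k) ≤ f (a + m) ↔ g k ≤ g m)) :
    Dominates f (a + i) (a + j) ↔ Dominates g i j := by
  constructor
  · intro H k h1 h2
    exact (h j (by grind) k h2).1 (H (a + k) (by grind) (by grind))
  · intro H k h1 h2
    obtain ⟨k, rfl⟩ := Nat.exists_eq_add_of_le (show a ≤ k by grind)
    exact (h j (by grind) k (by grind)).2 (H k (by grind) (by grind))

end Dominates

/-! ### The depths of the vertices of a binary tree in in-order -/

/-- The depth of the vertex at in-order position `i`. -/
def inorderDepth : BinaryTree Unit → ℕ → ℕ
  | .nil, _ => 0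
  | .node _ l r, i =>
    if i < l.numNodes then inorderDepth l i + 1
    else if i = l.numNodes then 0
    else inorderDepth r (i - (l.numNodes + 1)) + 1

section inorderDepth

variable {l r : BinaryTree Unit} {a : Unit} {i j : ℕ}

theorem inorderDepth_left (h : i < l.numNodes) :
    inorderDepth (.node a l r) i = inorderDepth l i + 1 := by
  simp [inorderDepth, h]

theorem inorderDepth_root : inorderDepth (.node a l r) l.numNodes = 0 := by
  simp [inorderDepth]

theorem inorderDepth_right :
    inorderDepth (.node a l r) (l.numNodes + 1 + i) = inorderDepth r i + 1 := by
  rw [inorderDepth, if_neg (by omega), if_neg (by omega)]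
  congr 2
  omega

theorem inorderDepth_root_lt (h : i ≠ l.numNodes) :
    inorderDepth (.node a l r) l.numNodes < inorderDepth (.node a l r) i := by
  rw [inorderDepth_root, inorderDepth]
  split_ifs <;> omega

theorem dominates_left (hi : i < l.numNodes) (hj : j < l.numNodes) :
    Dominates (inorderDepth (.node a l r)) i j ↔ Dominates (inorderDepth l) i j := by
  have := Dominates.congr_of_le (f := inorderDepth (.node a l r)) (g := inorderDepth l)
    (i := i) (j := j) (a := 0) (by
      intro k hk m hm
      rw [Nat.zero_add, Nat.zero_add, inorderDepth_left (by grind), inorderDepth_left (by grind)]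
      omega)
  simpa using this

theorem dominates_right :
    Dominates (inorderDepth (.node a l r)) (l.numNodes + 1 + i) (l.numNodes + 1 + j) ↔
      Dominates (inorderDepth r) i j := by
  refine Dominates.congr_of_le fun k hk m hm => ?_
  rw [inorderDepth_right, inorderDepth_right]
  omega

theorem dominates_root : Dominates (inorderDepth (.node a l r)) i l.numNodes := by
  intro k _ _
  rw [inorderDepth_root]
  exact Nat.zero_le _

end inorderDepth

theorem position_cases (i m : ℕ) : i < m ∨ i = m ∨ ∃ k, i = m + 1 + k := by
  rcases lt_trichotomy i m with h | h | h
  · exact Or.inl h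
  · exact Or.inr (Or.inl h)
  · exact Or.inr (Or.inr (Nat.exists_eq_add_of_le h))

/-- Distinct vertices of equal depth lie in different subtrees of their lowest common ancestor,
which is strictly between them in in-order. -/
theorem exists_inorderDepth_lt_between (T : BinaryTree Unit) {i j : ℕ} (hij : i < j)
    (hj : j < T.numNodes) (h : inorderDepth T i = inorderDepth T j) :
    ∃ k, i < k ∧ k < j ∧ inorderDepth T k < inorderDepth T i := by
  induction T generalizing i j with
  | nil => simp at hj
  | node a l r hl hr =>
    rw [BinaryTree.numNodes] at hj
    by_cases hjl : j < l.numNodes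
    · rw [inorderDepth_left hjl, inorderDepth_left (by omega)] at h
      obtain ⟨k, h1, h2, h3⟩ := hl hij hjl (by omega)
      refine ⟨k, h1, h2, ?_⟩
      rw [inorderDepth_left (by omega), inorderDepth_left (by omega)]
      omega
    by_cases hil : l.numNodes < i
    · obtain ⟨i, rfl⟩ := Nat.exists_eq_add_of_le (show l.numNodes + 1 ≤ i by omega)
      obtain ⟨j, rfl⟩ := Nat.exists_eq_add_of_le (show l.numNodes + 1 ≤ j by omega)
      rw [inorderDepth_right, inorderDepth_right] at h
      obtain ⟨k, h1, h2, h3⟩ := hr (i := i) (j := j) (by omega) (by omega) (by omega)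
      refine ⟨l.numNodes + 1 + k, by omega, by omega, ?_⟩
      rw [inorderDepth_right, inorderDepth_right]
      omega
    by_cases hi : i = l.numNodes
    · subst hi
      have := inorderDepth_root_lt (a := a) (r := r) (show j ≠ l.numNodes by omega)
      omega
    by_cases hj' : j = l.numNodes
    · subst hj'
      have := inorderDepth_root_lt (a := a) (r := r) hi
      omega
    exact ⟨l.numNodes, by omega, by omega, inorderDepth_root_lt hi⟩

theorem dominates_antisymm (T : BinaryTree Unit) {i j : ℕ} (hi : i < T.numNodes)
    (hj : j < T.numNodes) (h : inorderDepth T i ≤ inorderDepth T j)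
    (hd : Dominates (inorderDepth T) i j) : i = j := by
  have he := le_antisymm h hd.le
  by_contra hne
  rcases lt_or_gt_of_ne hne with hlt | hlt
  · obtain ⟨k, h1, h2, h3⟩ := exists_inorderDepth_lt_between T hlt hj he
    have := hd k (by grind) (by grind)
    omega
  · obtain ⟨k, h1, h2, h3⟩ := exists_inorderDepth_lt_between T hlt hi he.symm
    have := hd k (by grind) (by grind)
    omega

theorem exists_ancestor (T : BinaryTree Unit) {i d : ℕ} (hi : i < T.numNodes)
    (hd : d ≤ inorderDepth T i) :
    ∃ j < T.numNodes, Dominates (inorderDepth T) i j ∧ inorderDepth T j = d := by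
  induction T generalizing i d with
  | nil => simp at hi
  | node a l r hl hr =>
    rw [BinaryTree.numNodes] at hi ⊢
    rcases d with _ | d
    · exact ⟨l.numNodes, by omega, dominates_root, inorderDepth_root⟩
    rcases position_cases i l.numNodes with h | rfl | ⟨i, rfl⟩
    · rw [inorderDepth_left h] at hd
      obtain ⟨j, h1, h2, h3⟩ := hl h (Nat.le_of_succ_le_succ hd)
      exact ⟨j, by omega, (dominates_left h h1).2 h2, by rw [inorderDepth_left h1, h3]⟩
    · rw [inorderDepth_root] at hd
      omega
    · rw [inorderDepth_right] at hd
      obtain ⟨j, h1, h2, h3⟩ := hr (by omega) (Nat.le_of_succ_le_succ hd)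
      exact ⟨l.numNodes + 1 + j, by omega, dominates_right.2 h2, by rw [inorderDepth_right, h3]⟩

/-- A tree is determined by its ancestor relation. -/
theorem tree_ext {T T' : BinaryTree Unit} (hn : T.numNodes = T'.numNodes)
    (h : ∀ i < T.numNodes, ∀ j < T.numNodes,
      (Dominates (inorderDepth T) i j ↔ Dominates (inorderDepth T') i j)) : T = T' := by
  induction T generalizing T' with
  | nil =>
    cases T' with
    | nil => rfl
    | node => simp at hn
  | node a l r hl hr =>
    cases T' with
    | nil => simp at hn
    | node a' l' r' =>
      have hroot : l.numNodes = l'.numNodes := by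
        by_contra hne
        -- The root of `T` dominates every vertex; transferred to `T'`, it would be at least as
        -- shallow as the root of `T'`.
        rw [BinaryTree.numNodes, BinaryTree.numNodes] at hn
        have h1 := (h l'.numNodes (by rw [BinaryTree.numNodes]; omega) l.numNodes
          (by rw [BinaryTree.numNodes]; omega)).1 dominates_root
        have h2 := h1.le
        have h3 := inorderDepth_root_lt (a := a') (r := r') hne
        omega
      have hnr : r.numNodes = r'.numNodes := by
        rw [BinaryTree.numNodes, BinaryTree.numNodes] at hn
        omega
      have e1 : l = l' := hl hroot fun i hi j hj => by
        have := h i (by rw [BinaryTree.numNodes]; omega) j (by rw [BinaryTree.numNodes]; omega)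
        rwa [dominates_left hi hj, dominates_left (hroot ▸ hi) (hroot ▸ hj)] at this
      have e2 : r = r' := hr hnr fun i hi j hj => by
        have := h (l.numNodes + 1 + i) (by rw [BinaryTree.numNodes]; omega)
          (l.numNodes + 1 + j) (by rw [BinaryTree.numNodes]; omega)
        rw [dominates_right] at this
        rwa [hroot, dominates_right] at this
      rw [e1, e2]

/-- Every function without ties for the minimum on intervals comes from a binary tree. -/
theorem exists_tree {α : Type*} [LinearOrder α] (m : ℕ) (f : ℕ → α)
    (hf : ∀ i < m, ∀ j < m, Dominates f i j → Dominates f j i → i = j) :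
    ∃ T : BinaryTree Unit, T.numNodes = m ∧ ∀ i < m, ∀ j < m,
      (Dominates f i j ↔ Dominates (inorderDepth T) i j) := by
  induction m using Nat.strong_induction_on generalizing f with
  | _ m ih =>
  rcases Nat.eq_zero_or_pos m with rfl | hm
  · exact ⟨.nil, rfl, by simp⟩
  obtain ⟨p, hp, hmin⟩ := Finset.exists_min_image (Finset.range m) f ⟨0, by simpa using hm⟩
  rw [Finset.mem_range] at hp
  have hmin' : ∀ i < m, f p ≤ f i := fun i hi => hmin i (Finset.mem_range.2 hi)
  -- Two global minima would dominate each other. The unique one becomes the root, with the two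
  -- sides as subtrees.
  have hstrict : ∀ i < m, i ≠ p → f p < f i := by
    intro i hi hne
    refine lt_of_le_of_ne (hmin' i hi) fun he => hne (hf i hi p hp ?_ ?_)
    · exact fun k _ h2 => hmin' k (by grind)
    · exact fun k _ h2 => he ▸ hmin' k (by grind)
  have shift : ∀ i j, Dominates f (p + 1 + i) (p + 1 + j) ↔
      Dominates (fun k => f (p + 1 + k)) i j := fun i j =>
    Dominates.congr_of_le fun _ _ _ _ => Iff.rfl
  obtain ⟨l, hl, hl'⟩ := ih p hp f fun i hi j hj => hf i (hi.trans hp) j (hj.trans hp)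
  obtain ⟨r, hr, hr'⟩ := ih (m - (p + 1)) (by omega) (fun k => f (p + 1 + k))
    fun i hi j hj h1 h2 => by
      have := hf (p + 1 + i) (by omega) (p + 1 + j) (by omega) ((shift _ _).2 h1) ((shift _ _).2 h2)
      omega
  subst hl
  refine ⟨.node () l r, by rw [BinaryTree.numNodes]; omega, fun i hi j hj => ?_⟩
  refine Dominates.iff_of_strict_min hstrict (fun i _ h => inorderDepth_root_lt h)
    (fun i hi j hj => ?_) (fun i j hi hj => ?_) hi hj
  · rw [hl' i hi j hj, dominates_left hi hj]
  · rw [shift, hr' i (by omega) j (by omega), dominates_right]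

theorem vertexDepths_eq (T : BinaryTree Unit) :
    vertexDepths T = (Multiset.range T.numNodes).map (inorderDepth T) := by
  induction T with
  | nil => rfl
  | node a l r hl hr =>
    rw [vertexDepths, BinaryTree.numNodes, show l.numNodes + r.numNodes + 1 =
      (l.numNodes + 1) + r.numNodes by ring, Multiset.range_add, Multiset.map_add,
      Multiset.range_succ, Multiset.cons_add, Multiset.map_cons, inorderDepth_root, hl, hr,
      Multiset.map_add, Multiset.map_map, Multiset.map_map, Multiset.map_map]
    congr 2
    · refine Multiset.map_congr rfl fun i hi => ?_
      rw [inorderDepth_left (Multiset.mem_range.1 hi)]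
      rfl
    · refine Multiset.map_congr rfl fun i hi => ?_
      simp only [Function.comp_apply, inorderDepth_right]

theorem inorderDepth_le_depth (T : BinaryTree Unit) {i : ℕ} (hi : i < T.numNodes) :
    inorderDepth T i ≤ depth T :=
  Multiset.le_sup (by
    rw [vertexDepths_eq]
    exact Multiset.mem_map_of_mem _ (Multiset.mem_range.2 hi))

theorem exists_inorderDepth_eq_depth (T : BinaryTree Unit) (h : 0 < T.numNodes) :
    ∃ i < T.numNodes, inorderDepth T i = depth T := by
  obtain ⟨i, hi, hmax⟩ := Finset.exists_max_image (Finset.range T.numNodes) (inorderDepth T)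
    ⟨0, by simpa using h⟩
  rw [Finset.mem_range] at hi
  refine ⟨i, hi, le_antisymm (inorderDepth_le_depth T hi) ?_⟩
  refine Multiset.sup_le.2 fun d hd => ?_
  rw [vertexDepths_eq, Multiset.mem_map] at hd
  obtain ⟨j, hj, rfl⟩ := hd
  exact hmax j (by simpa using hj)

/-- The vertices with a right child are the ascents of the sequence of depths. -/
theorem rightMultiset_eq (T : BinaryTree Unit) :
    rightMultiset T = ((Multiset.range T.numNodes).filter fun j =>
      j + 1 < T.numNodes ∧ inorderDepth T j < inorderDepth T (j + 1)).map (inorderDepth T) := by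
  induction T with
  | nil => rfl
  | node a l r hl hr =>
    rw [rightMultiset, show (BinaryTree.node a l r).numNodes =
      (l.numNodes + 1) + r.numNodes by rw [BinaryTree.numNodes]; ring,
      Multiset.range_add,
      Multiset.range_succ, ← Multiset.singleton_add, Multiset.filter_add, Multiset.filter_add,
      Multiset.map_add, Multiset.map_add, Multiset.map_add, hl, hr, Multiset.map_map,
      Multiset.map_map, add_assoc]
    congr 1
    · cases r with
      | nil => simp
      | node b rl rr =>
        have := inorderDepth_root_lt (a := a) (l := l) (r := .node b rl rr)
          (i := l.numNodes + 1) (by omega)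
        rw [if_neg (by simp), Multiset.filter_singleton, 
          if_pos ⟨by rw [BinaryTree.numNodes]; omega, this⟩, Multiset.map_singleton,
          inorderDepth_root]
    congr 1
    · rw [Multiset.filter_congr (p := fun j => j + 1 < l.numNodes ∧ _)
        (q := fun j => j + 1 < l.numNodes + 1 + r.numNodes ∧
          inorderDepth (.node a l r) j < inorderDepth (.node a l r) (j + 1)) ?_]
      · refine Multiset.map_congr rfl fun i hi => ?_
        rw [Multiset.mem_filter, Multiset.mem_range] at hi
        rw [inorderDepth_left hi.1]
        rfl
      · intro j hj
        rw [Multiset.mem_range] at hj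
        by_cases hj' : j + 1 < l.numNodes
        · rw [inorderDepth_left hj, inorderDepth_left hj']
          omega
        -- The successor of the last vertex of `l` is the root, at depth 0, so no ascent occurs
        -- there.
        · have : j + 1 = l.numNodes := by omega
          rw [this, inorderDepth_root]
          omega
    · rw [Multiset.filter_map, Multiset.map_map]
      rw [Multiset.filter_congr (p := fun j => j + 1 < r.numNodes ∧ _)
        (q := (fun j => j + 1 < l.numNodes + 1 + r.numNodes ∧
          inorderDepth (.node a l r) j < inorderDepth (.node a l r) (j + 1)) ∘
            fun x => l.numNodes + 1 + x) ?_]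
      · refine Multiset.map_congr rfl fun i hi => ?_
        simp only [Function.comp_apply, inorderDepth_right]
      · intro j hj
        simp only [Function.comp_apply]
        rw [add_assoc (l.numNodes + 1) j 1, inorderDepth_right, inorderDepth_right]
        omega

/-! ### Normal cones of nestohedra -/

section Nestohedron

variable {n : ℕ}

theorem mem_simplexOf {I : Finset (Fin n)} {d : Fin n → ℝ} (hd : d ∈ simplexOf I) :
    (∀ i, 0 ≤ d i) ∧ ∑ i, d i = 1 ∧ ∀ i, i ∉ I → d i = 0 := by
  have hconv : Convex ℝ {d : Fin n → ℝ | (∀ i, 0 ≤ d i) ∧ ∑ i, d i = 1 ∧ ∀ i, i ∉ I → d i = 0} := by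
    rintro x ⟨hx1, hx2, hx3⟩ z ⟨hz1, hz2, hz3⟩ a b ha hb hab
    refine ⟨fun i => ?_, ?_, fun i hi => ?_⟩
    · have := mul_nonneg ha (hx1 i)
      have := mul_nonneg hb (hz1 i)
      simp only [Pi.add_apply, Pi.smul_apply, smul_eq_mul]
      linarith
    · simp only [Pi.add_apply, Pi.smul_apply, smul_eq_mul]
      rw [Finset.sum_add_distrib, ← Finset.mul_sum, ← Finset.mul_sum, hx2, hz2]
      linarith
    · simp [hx3 i hi, hz3 i hi]
  refine convexHull_min ?_ hconv hd
  rintro _ ⟨i, hi, rfl⟩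
  refine ⟨fun j => ?_, by simp, fun j hj => ?_⟩
  · by_cases h : j = i
    · subst h; simp
    · simp [h]
  · refine Pi.single_eq_of_ne ?_ _
    rintro rfl
    exact hj hi

theorem single_mem_simplexOf {I : Finset (Fin n)} {i : Fin n} (hi : i ∈ I) :
    (Pi.single i 1 : Fin n → ℝ) ∈ simplexOf I :=
  subset_convexHull ℝ _ ⟨i, hi, rfl⟩

theorem dotProduct_le_of_mem_simplexOf {I : Finset (Fin n)} {d l : Fin n → ℝ} {M : ℝ}
    (hd : d ∈ simplexOf I) (hM : ∀ i ∈ I, l i ≤ M) : l ⬝ᵥ d ≤ M := by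
  obtain ⟨h0, h1, hI⟩ := mem_simplexOf hd
  calc l ⬝ᵥ d ≤ ∑ i, M * d i := by
        refine Finset.sum_le_sum fun i _ => ?_
        by_cases hi : i ∈ I
        · exact mul_le_mul_of_nonneg_right (hM i hi) (h0 i)
        · simp [hI i hi]
    _ = M := by rw [← Finset.mul_sum, h1, mul_one]

/-- The nonnegative terms `(M - l i) * d i` sum to zero, so `d` is supported where `l` equals `M`,
and there `x` is constant. -/
theorem dotProduct_eq_of_argmax {I : Finset (Fin n)} {d l x : Fin n → ℝ} {M N : ℝ}
    (hd : d ∈ simplexOf I) (hM : ∀ i ∈ I, l i ≤ M) (hx : ∀ i ∈ I, l i = M → x i = N)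
    (h : l ⬝ᵥ d = M) : x ⬝ᵥ d = N := by
  obtain ⟨h0, h1, hI⟩ := mem_simplexOf hd
  have hzero : ∑ i, (M - l i) * d i = 0 := by
    have h2 : ∑ i, l i * d i = M := h
    simp only [sub_mul]
    rw [Finset.sum_sub_distrib, ← Finset.mul_sum, h1, h2]
    ring
  rw [Finset.sum_eq_zero_iff_of_nonneg] at hzero
  · calc x ⬝ᵥ d = ∑ i, N * d i := by
          refine Finset.sum_congr rfl fun i hi => ?_
          rcases mul_eq_zero.1 (hzero i hi) with h3 | h3
          · by_cases hiI : i ∈ I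
            · rw [hx i hiI (by linarith)]
            · simp [hI i hiI]
          · rw [h3]; simp
      _ = N := by rw [← Finset.mul_sum, h1, mul_one]
  · intro i _
    by_cases hi : i ∈ I
    · exact mul_nonneg (sub_nonneg.2 (hM i hi)) (h0 i)
    · simp [hI i hi]

variable {B : Finset (Finset (Fin n))} {y : Finset (Fin n) → ℝ}

theorem sum_single_mem_nestohedron {v : Finset (Fin n) → Fin n} (hv : ∀ I ∈ B, v I ∈ I) :
    ∑ I ∈ B, y I • (Pi.single (v I) 1 : Fin n → ℝ) ∈ nestohedron B y :=
  Set.finsetSum_mem_finsetSum _ _ _ fun I hI =>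
    Set.smul_mem_smul_set (single_mem_simplexOf (hv I hI))

theorem exists_of_mem_nestohedron {z : Fin n → ℝ} (hz : z ∈ nestohedron B y) :
    ∃ d : Finset (Fin n) → Fin n → ℝ,
      (∀ I ∈ B, d I ∈ simplexOf I) ∧ ∀ l : Fin n → ℝ, l ⬝ᵥ z = ∑ I ∈ B, y I * (l ⬝ᵥ d I) := by
  classical
  obtain ⟨g, hg, rfl⟩ := (Set.mem_finsetSum _ _ _).1 hz
  have : ∀ I, ∃ d, I ∈ B → d ∈ simplexOf I ∧ y I • d = g I := by
    intro I
    by_cases hI : I ∈ B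
    · obtain ⟨d, h1, h2⟩ := hg hI
      exact ⟨d, fun _ => ⟨h1, h2⟩⟩
    · exact ⟨0, fun h => absurd h hI⟩
  choose d hd using this
  refine ⟨d, fun I hI => (hd I hI).1, fun l => ?_⟩
  rw [dotProduct_sum]
  refine Finset.sum_congr rfl fun I hI => ?_
  rw [← (hd I hI).2, dotProduct_smul, smul_eq_mul]

theorem dotProduct_sum_single (l : Fin n → ℝ) (v : Finset (Fin n) → Fin n) :
    l ⬝ᵥ ∑ I ∈ B, y I • (Pi.single (v I) 1 : Fin n → ℝ) = ∑ I ∈ B, y I * l (v I) := by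
  rw [dotProduct_sum]
  simp [dotProduct_smul]

theorem mem_maxFace_of_argmax (hy : ∀ I ∈ B, 0 < y I) {l : Fin n → ℝ}
    {v : Finset (Fin n) → Fin n} (hv : ∀ I ∈ B, v I ∈ I) (hmax : ∀ I ∈ B, ∀ j ∈ I, l j ≤ l (v I)) :
    ∑ I ∈ B, y I • (Pi.single (v I) 1 : Fin n → ℝ) ∈ maxFace (nestohedron B y) l := by
  refine ⟨sum_single_mem_nestohedron hv, fun z hz => ?_⟩
  obtain ⟨d, hd, hz'⟩ := exists_of_mem_nestohedron hz
  rw [hz', dotProduct_sum_single]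
  exact Finset.sum_le_sum fun I hI => mul_le_mul_of_nonneg_left
    (dotProduct_le_of_mem_simplexOf (hd I hI) (hmax I hI)) (hy I hI).le

/-- The normal cone of the face maximizing `l` consists of the functionals that are maximal at every
maximum of `l` on a member of the building set. -/
theorem normalCone_maxFace_nestohedron [Nonempty (Fin n)] (hy : ∀ I ∈ B, 0 < y I) (hB : ∀ I ∈ B, I.Nonempty)
    (l : Fin n → ℝ) :
    normalCone (nestohedron B y) (maxFace (nestohedron B y) l) =
      {x | ∀ I ∈ B, ∀ i ∈ I, (∀ j ∈ I, l j ≤ l i) → ∀ j ∈ I, x j ≤ x i} := by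
  classical
  have hex : ∀ I, ∃ i, I ∈ B → i ∈ I ∧ ∀ j ∈ I, l j ≤ l i := by
    intro I
    by_cases hI : I ∈ B
    · obtain ⟨i, h1, h2⟩ := Finset.exists_max_image I l (hB I hI)
      exact ⟨i, fun _ => ⟨h1, h2⟩⟩
    · exact ⟨Classical.arbitrary _, fun h => absurd h hI⟩
  choose v hv using hex
  ext x
  constructor
  · intro hx I hI i hi hmax j hj
    -- Two points of the polytope that differ only in the vertex chosen from the summand `I`:
    -- comparing them leaves `x j ≤ x i` after cancelling `y I`.
    have h1 := mem_maxFace_of_argmax (v := Function.update v I i) hy (l := l)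
      (fun J hJ => by
        by_cases h : J = I
        · subst h; simpa using hi
        · simpa [h] using (hv J hJ).1)
      (fun J hJ => by
        by_cases h : J = I
        · subst h; simpa using hmax
        · simpa [h] using (hv J hJ).2)
    have h2 := sum_single_mem_nestohedron (y := y) (B := B) (v := Function.update v I j)
      (fun J hJ => by
        by_cases h : J = I
        · subst h; simpa using hj
        · simpa [h] using (hv J hJ).1)
    have h3 := hx _ h1 _ h2
    rw [dotProduct_sum_single, dotProduct_sum_single, ← Finset.add_sum_erase _ _ hI,
      ← Finset.add_sum_erase B (fun J => y J * x (Function.update v I i J)) hI,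
      Finset.sum_congr (g := fun J => y J * x (Function.update v I i J)) rfl ?_] at h3
    · simp only [Function.update_self] at h3
      exact le_of_mul_le_mul_left (by linarith) (hy I hI)
    · intro J hJ
      simp [Finset.ne_of_mem_erase hJ]
  · intro hx z hz w hw
    obtain ⟨d, hd, hd'⟩ := exists_of_mem_nestohedron hz.1
    obtain ⟨e, he, he'⟩ := exists_of_mem_nestohedron hw
    have hle : ∀ I ∈ B, y I * (l ⬝ᵥ d I) ≤ y I * l (v I) := fun I hI =>
      mul_le_mul_of_nonneg_left (dotProduct_le_of_mem_simplexOf (hd I hI) (hv I hI).2) (hy I hI).le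
    have hsum := hz.2 _ (sum_single_mem_nestohedron (y := y) fun I hI => (hv I hI).1)
    rw [dotProduct_sum_single, hd'] at hsum
    -- A point maximal for `l` on the sum is maximal in every summand.
    have heq := (Finset.sum_eq_sum_iff_of_le hle).1 (le_antisymm (Finset.sum_le_sum hle) hsum)
    rw [hd', he']
    refine Finset.sum_le_sum fun I hI => mul_le_mul_of_nonneg_left ?_ (hy I hI).le
    have h1 : x ⬝ᵥ d I = x (v I) := by
      refine dotProduct_eq_of_argmax (hd I hI) (hv I hI).2 (fun i hi hmax => ?_)
        (mul_left_cancel₀ (hy I hI).ne' (heq I hI))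
      exact le_antisymm (hx I hI (v I) (hv I hI).1 (hv I hI).2 i hi)
        (hx I hI i hi (fun j hj => hmax ▸ (hv I hI).2 j hj) _ (hv I hI).1)
    rw [h1]
    exact dotProduct_le_of_mem_simplexOf (he I hI) (hx I hI (v I) (hv I hI).1 (hv I hI).2)

end Nestohedron

/-! ### The building set of the path -/

section Path

variable {n : ℕ}

theorem uIcc_mem_graphBuildingSet (i j : Fin n) :
    Finset.uIcc i j ∈ graphBuildingSet (SimpleGraph.pathGraph n) := by
  classical
  refine Finset.mem_insert_of_mem (Finset.mem_filter.2 ⟨Finset.mem_univ _, ?_⟩)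
  rw [SimpleGraph.connected_iff_exists_forall_reachable]
  refine ⟨⟨i ⊓ j, Finset.mem_Icc.2 ⟨le_rfl, inf_le_sup⟩⟩, ?_⟩
  rintro ⟨k, hk⟩
  obtain ⟨m, hm⟩ : ∃ m, (k : ℕ) = (i ⊓ j : Fin n) + m :=
    Nat.exists_eq_add_of_le (Finset.mem_Icc.1 hk).1
  induction m generalizing k with
  | zero =>
    have : k = i ⊓ j := Fin.ext hm
    subst this
    rfl
  | succ m ih =>
    have hk' := Finset.mem_Icc.1 hk
    have h1 : ((i ⊓ j : Fin n) : ℕ) + m < n := by omega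
    have h2 : (⟨(i ⊓ j : Fin n) + m, h1⟩ : Fin n) ∈ (Finset.uIcc i j : Set (Fin n)) :=
      Finset.mem_Icc.2 ⟨Fin.le_def.2 (by simp), Fin.le_def.2 (by
        have := Fin.le_def.1 hk'.2
        simp only
        omega)⟩
    refine (ih _ h2 rfl).trans (SimpleGraph.Adj.reachable ?_)
    rw [SimpleGraph.induce_adj, SimpleGraph.pathGraph_adj]
    left
    simp only
    omega

theorem uIcc_subset_of_mem_graphBuildingSet {I : Finset (Fin n)}
    (hI : I ∈ graphBuildingSet (SimpleGraph.pathGraph n)) {i j : Fin n} (hi : i ∈ I) (hj : j ∈ I) :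
    Finset.uIcc i j ⊆ I := by
  classical
  rcases Finset.mem_insert.1 hI with rfl | hI
  · exact Finset.subset_univ _
  have hc := (Finset.mem_filter.1 hI).2
  intro k hk
  by_contra hkI
  -- Adjacent labels differ by one, so a walk avoiding `k` cannot cross it.
  have key : ∀ a b : (I : Set (Fin n)),
      ((SimpleGraph.pathGraph n).induce (I : Set (Fin n))).Reachable a b → a.1 < k → b.1 < k := by
    intro a b hab ha
    rw [SimpleGraph.reachable_iff_reflTransGen] at hab
    induction hab with
    | refl => exact ha
    | @tail b c _ hbc ih =>
      rw [SimpleGraph.induce_adj, SimpleGraph.pathGraph_adj] at hbc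
      have hne : c.1 ≠ k := fun h => hkI (h ▸ c.2)
      rw [Fin.lt_def] at ih ⊢
      rw [Ne, Fin.ext_iff] at hne
      omega
  have h1 := key ⟨i, hi⟩ ⟨j, hj⟩ (hc.preconnected _ _)
  have h2 := key ⟨j, hj⟩ ⟨i, hi⟩ (hc.preconnected _ _)
  have h3 : i ≠ k := fun h => hkI (h ▸ hi)
  have h4 : j ≠ k := fun h => hkI (h ▸ hj)
  rw [Finset.mem_uIcc] at hk
  simp only at h1 h2
  grind

theorem nonempty_of_mem_graphBuildingSet (hn : 1 ≤ n) {I : Finset (Fin n)}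
    (hI : I ∈ graphBuildingSet (SimpleGraph.pathGraph n)) : I.Nonempty := by
  classical
  rcases Finset.mem_insert.1 hI with rfl | hI
  · exact ⟨⟨0, hn⟩, Finset.mem_univ _⟩
  · obtain ⟨⟨i, hi⟩⟩ := (Finset.mem_filter.1 hI).2.nonempty
    exact ⟨i, hi⟩

/-- The values of a functional as a function of the positions, in reversed order. -/
def negExtend (l : Fin n → ℝ) (k : ℕ) : ℝ := if h : k < n then - l ⟨k, h⟩ else 0

theorem dominates_negExtend (l : Fin n → ℝ) (i j : Fin n) :
    Dominates (negExtend l) i j ↔ ∀ k ∈ Finset.uIcc i j, l k ≤ l j := by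
  constructor
  · intro h k hk
    rw [Finset.mem_uIcc'] at hk
    have := h k (by grind) (by grind)
    simpa [negExtend] using this
  · intro h k h1 h2
    have hk : k < n := by grind
    have := h ⟨k, hk⟩ (by rw [Finset.mem_uIcc]; grind)
    simpa [negExtend, hk] using this

/-- The functionals that are monotone along the relation `Dominates f`. -/
def dominanceCone {α : Type*} [LinearOrder α] (n : ℕ) (f : ℕ → α) : Set (Fin n → ℝ) :=
  {x | ∀ i j : Fin n, Dominates f i j → x i ≤ x j}

theorem normalCone_maxFace_path (hn : 1 ≤ n) {y : Finset (Fin n) → ℝ}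
    (hy : ∀ I ∈ graphBuildingSet (SimpleGraph.pathGraph n), 0 < y I) (l : Fin n → ℝ) :
    normalCone (graphAssociahedron (SimpleGraph.pathGraph n) y)
      (maxFace (graphAssociahedron (SimpleGraph.pathGraph n) y) l) =
        dominanceCone n (negExtend l) := by
  have : Nonempty (Fin n) := ⟨⟨0, hn⟩⟩
  rw [graphAssociahedron,
    normalCone_maxFace_nestohedron hy fun I => nonempty_of_mem_graphBuildingSet hn]
  ext x
  constructor
  · intro h i j hij
    exact h _ (uIcc_mem_graphBuildingSet i j) j Finset.right_mem_uIcc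
      ((dominates_negExtend l i j).1 hij) i Finset.left_mem_uIcc
  · intro h I hI i hi hmax j hj
    exact h j i ((dominates_negExtend l j i).2 fun k hk =>
      hmax k (uIcc_subset_of_mem_graphBuildingSet hI hj hi hk))

variable {α : Type*} [LinearOrder α] {f : ℕ → α}

/-- The indicator of the up-set generated by `i` lies in the cone by transitivity and separates `i`
from each `j` outside that up-set. -/
theorem forall_mem_dominanceCone_le_iff (i j : Fin n) :
    (∀ x ∈ dominanceCone n f, x i ≤ x j) ↔ Dominates f i j := by
  classical
  refine ⟨fun h => ?_, fun h x hx => hx i j h⟩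
  by_contra hij
  have := h (fun k => if Dominates f i k then 1 else 0) (by
    intro k m hkm
    by_cases hk : Dominates f i k
    · simp [hk, hk.trans hkm]
    · simp only [hk, if_false]
      split_ifs <;> norm_num)
  simp only [Dominates.refl f i, hij, if_true, if_false] at this
  linarith

theorem dominanceCone_eq_iff {β : Type*} [LinearOrder β] {g : ℕ → β} :
    dominanceCone n f = dominanceCone n g ↔
      ∀ i j : Fin n, Dominates f i j ↔ Dominates g i j := by
  constructor
  · intro h i j
    rw [← forall_mem_dominanceCone_le_iff, h, forall_mem_dominanceCone_le_iff]
  · intro h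
    ext x
    exact forall_congr' fun i => forall_congr' fun j => by rw [h]

end Path

/-! ### Full-dimensional cones and binary trees -/

/-- The cone of the functionals increasing from children to parents. -/
def treeCone (n : ℕ) (T : BinaryTree Unit) : Set (Fin n → ℝ) := dominanceCone n (inorderDepth T)

/-- Negated depths increase by at least 1 along each strict relation, so adding any vector of the
unit cube stays in the cone. Differences of such points give the standard basis. -/
theorem span_treeCone (T : BinaryTree Unit) :
    Submodule.span ℝ (treeCone T.numNodes T) = ⊤ := by
  classical
  have hmem : ∀ x : Fin T.numNodes → ℝ, (∀ i, 0 ≤ x i) → (∀ i, x i ≤ 1) →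
      (fun i : Fin T.numNodes => x i - (inorderDepth T i : ℝ)) ∈ treeCone T.numNodes T := by
    intro x h0 h1 i j hij
    by_cases he : i = j
    · rw [he]
    have : inorderDepth T j < inorderDepth T i := by
      by_contra hlt
      exact he (Fin.ext (dominates_antisymm T i.2 j.2 (not_lt.1 hlt) hij))
    have : (inorderDepth T j : ℝ) + 1 ≤ inorderDepth T i := by exact_mod_cast this
    have := h0 j
    have := h1 i
    simp only
    linarith
  rw [eq_top_iff, ← (Pi.basisFun ℝ (Fin T.numNodes)).span_eq, Submodule.span_le]
  rintro _ ⟨i, rfl⟩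
  have h1 := Submodule.subset_span (R := ℝ) (hmem (Pi.single i 1)
    (fun j => by by_cases h : j = i <;> simp [h])
    (fun j => by by_cases h : j = i <;> simp [h]))
  have h2 := Submodule.subset_span (R := ℝ) (hmem 0 (by simp) (by simp))
  have h3 := Submodule.sub_mem _ h1 h2
  have h4 : (Pi.basisFun ℝ (Fin T.numNodes)) i =
      (fun j => (Pi.single i 1 : Fin T.numNodes → ℝ) j - (inorderDepth T j : ℝ)) -
        fun j => (0 : Fin T.numNodes → ℝ) j - (inorderDepth T j : ℝ) := by
    ext j
    simp
  rw [h4]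
  exact h3

section fullCones

variable {n : ℕ} {y : Finset (Fin n) → ℝ}

theorem treeCone_mem_fullCones (hn : 1 ≤ n)
    (hy : ∀ I ∈ graphBuildingSet (SimpleGraph.pathGraph n), 0 < y I) {T : BinaryTree Unit}
    (hT : T.numNodes = n) :
    treeCone n T ∈ fullCones (graphAssociahedron (SimpleGraph.pathGraph n) y) := by
  refine ⟨⟨fun i => - (inorderDepth T i : ℝ), ?_⟩, by subst hT; exact span_treeCone T⟩
  rw [normalCone_maxFace_path hn hy, treeCone, dominanceCone_eq_iff]
  intro i j
  rw [dominates_negExtend]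
  constructor
  · intro h k hk
    rw [Finset.mem_uIcc] at hk
    have := h k (by grind) (by grind)
    simpa using this
  · intro h k h1 h2
    have hk : k < n := by grind
    have := h ⟨k, hk⟩ (by rw [Finset.mem_uIcc]; grind)
    simpa using this

theorem exists_treeCone_eq (hn : 1 ≤ n)
    (hy : ∀ I ∈ graphBuildingSet (SimpleGraph.pathGraph n), 0 < y I)
    (σ : fullCones (graphAssociahedron (SimpleGraph.pathGraph n) y)) :
    ∃ T : BinaryTree Unit, T.numNodes = n ∧ treeCone n T = σ := by
  obtain ⟨σ, ⟨l, rfl⟩, hσ⟩ := σ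
  have hcone := normalCone_maxFace_path hn hy l
  -- Full dimension enters here: antisymmetry of the cone's poset rules out ties.
  obtain ⟨T, hT, hT'⟩ := exists_tree n (negExtend l) fun i hi j hj h1 h2 => by
    have := (conePoset _ hσ).le_antisymm ⟨i, hi⟩ ⟨j, hj⟩
      (fun x hx => by rw [hcone] at hx; exact hx ⟨i, hi⟩ ⟨j, hj⟩ h1)
      (fun x hx => by rw [hcone] at hx; exact hx ⟨j, hj⟩ ⟨i, hi⟩ h2)
    simpa using this
  refine ⟨T, hT, ?_⟩
  simp only [hcone]
  rw [treeCone, dominanceCone_eq_iff]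
  exact fun i j => (hT' i i.2 j j.2).symm

theorem treeCone_injective {T T' : BinaryTree Unit} (hT : T.numNodes = n) (hT' : T'.numNodes = n)
    (h : treeCone n T = treeCone n T') : T = T' := by
  rw [treeCone, treeCone, dominanceCone_eq_iff] at h
  subst hT
  exact tree_ext hT'.symm fun i hi j hj => h ⟨i, hi⟩ ⟨j, hj⟩

/-- Binary trees on `n` vertices correspond to the full-dimensional cones of the associahedron. -/
def treeConeEquiv (hn : 1 ≤ n)
    (hy : ∀ I ∈ graphBuildingSet (SimpleGraph.pathGraph n), 0 < y I) :
    BinaryTree.treesOfNumNodesEq n ≃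
      fullCones (graphAssociahedron (SimpleGraph.pathGraph n) y) :=
  Equiv.ofBijective
    (fun T => ⟨treeCone n T.1, treeCone_mem_fullCones hn hy
      (BinaryTree.mem_treesOfNumNodesEq.1 T.2)⟩)
    ⟨fun T T' h => Subtype.ext (treeCone_injective (BinaryTree.mem_treesOfNumNodesEq.1 T.2)
        (BinaryTree.mem_treesOfNumNodesEq.1 T'.2) (congrArg Subtype.val h)),
      fun σ => by
        obtain ⟨T, hT, h⟩ := exists_treeCone_eq hn hy σ
        exact ⟨⟨T, BinaryTree.mem_treesOfNumNodesEq.2 hT⟩, Subtype.ext h⟩⟩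

theorem fanPoset_treeConeEquiv_le (hn : 1 ≤ n)
    (hy : ∀ I ∈ graphBuildingSet (SimpleGraph.pathGraph n), 0 < y I)
    (T : BinaryTree.treesOfNumNodesEq n) (i j : Fin n) :
    (fanPoset _ (treeConeEquiv hn hy T)).le i j ↔ Dominates (inorderDepth T.1) i j :=
  forall_mem_dominanceCone_le_iff i j

end fullCones

/-! ### The poset of a binary tree -/

section TreePoset

variable {n : ℕ} {Q : PartialOrder (Fin n)} {T : BinaryTree Unit}

/-- `Q` is the poset of `T`, with the in-order labelling and the root on top. -/
def IsTreePoset (Q : PartialOrder (Fin n)) (T : BinaryTree Unit) : Prop :=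
  T.numNodes = n ∧ ∀ i j, Q.le i j ↔ Dominates (inorderDepth T) i j

theorem IsTreePoset.covers_iff (h : IsTreePoset Q T) (i j : Fin n) :
    Covers Q i j ↔
      Dominates (inorderDepth T) i j ∧ inorderDepth T i = inorderDepth T j + 1 := by
  obtain ⟨hT, hle⟩ := h
  subst hT
  have hlt : ∀ a b : Fin T.numNodes, Q.lt a b →
      Dominates (inorderDepth T) a b ∧ inorderDepth T b < inorderDepth T a := by
    intro a b hab
    have h1 := (Q.lt_iff_le_not_ge a b).1 hab
    have h2 := (hle a b).1 h1.1
    refine ⟨h2, ?_⟩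
    by_contra hge
    have := Fin.ext (dominates_antisymm T a.2 b.2 (not_lt.1 hge) h2)
    subst this
    exact h1.2 h1.1
  have hlt' : ∀ a b : Fin T.numNodes, Dominates (inorderDepth T) a b →
      inorderDepth T b < inorderDepth T a → Q.lt a b := by
    intro a b h1 h2
    refine (Q.lt_iff_le_not_ge a b).2 ⟨(hle a b).2 h1, fun h3 => ?_⟩
    have := ((hle b a).1 h3).le
    omega
  constructor
  · rintro ⟨h1, h2⟩
    obtain ⟨hd, hlt1⟩ := hlt i j h1
    refine ⟨hd, ?_⟩
    by_contra hne
    -- If the depths differ by more than one, the ancestor of `i` one level below `j` lies strictly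
    -- between them.
    obtain ⟨k, hk, hik, hkd⟩ := exists_ancestor T i.2 (d := inorderDepth T j + 1) (by omega)
    exact h2 (c := ⟨k, hk⟩) (hlt' i ⟨k, hk⟩ hik (by simp only; omega))
      (hlt' ⟨k, hk⟩ j (hik.of_common hd (by omega)) (by simp only; omega))
  · rintro ⟨hd, h1⟩
    refine ⟨hlt' i j hd (by omega), fun k hk1 hk2 => ?_⟩
    have := (hlt _ _ hk1).2
    have := (hlt _ _ hk2).2
    omega

/-- Climbing to the root raises a rank function by the depth of the starting vertex. From a deepest
vertex this forces at least `depth T` at the root, which bounds the rank of every other vertex from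
below. -/
theorem IsTreePoset.isLeast_rank (h : IsTreePoset Q T) (hn : 0 < n) :
    IsLeast {ρ | IsRankFunction Q ρ} fun i : Fin n => depth T - inorderDepth T i := by
  have hT := h.1
  subst hT
  have hle := fun i : Fin T.numNodes => inorderDepth_le_depth T i.2
  constructor
  · intro i j hij
    have := ((h.covers_iff i j).1 hij).2
    have := hle i
    simp only
    omega
  · intro ρ hρ
    have key : ∀ d, ∀ i : Fin T.numNodes, inorderDepth T i = d →
        ∀ r < T.numNodes, ∀ hr : r < T.numNodes, inorderDepth T r = 0 →
          Dominates (inorderDepth T) i r → ρ ⟨r, hr⟩ = ρ i + d := by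
      intro d
      induction d with
      | zero =>
        intro i hi r _ hr hr0 hd
        have : (i : ℕ) = r := dominates_antisymm T i.2 hr (by omega) hd
        subst this
        rfl
      | succ d ih =>
        intro i hi r hr' hr hr0 hd
        obtain ⟨k, hk, hik, hkd⟩ := exists_ancestor T i.2 (d := d) (by omega)
        have h1 := hρ i ⟨k, hk⟩ ((h.covers_iff _ _).2 ⟨hik, by simp only; omega⟩)
        have h2 := ih ⟨k, hk⟩ hkd r hr' hr hr0 (hik.of_common hd (by omega))
        omega
    obtain ⟨m, hm, hmd⟩ := exists_inorderDepth_eq_depth T hn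
    intro i
    obtain ⟨r, hr, hmr, hr0⟩ := exists_ancestor T hm (Nat.zero_le _)
    obtain ⟨r', hr', hir, hr0'⟩ := exists_ancestor T i.2 (Nat.zero_le _)
    have hrr : r = r' := by
      have hall : Dominates (inorderDepth T) r r' := fun k _ _ => by rw [hr0']; exact Nat.zero_le _
      exact dominates_antisymm T hr hr' (by omega) hall
    subst hrr
    have h1 := key _ ⟨m, hm⟩ rfl r hr hr hr0 hmr
    have h2 := key _ i rfl r hr hr hr0 hir
    simp only at h1 ⊢
    omega

theorem minRank_eq_of_isLeast {ρ : Fin n → ℕ} (h : IsLeast {ρ | IsRankFunction Q ρ} ρ) :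
    minRank Q = ρ := by
  funext i
  refine IsLeast.csInf_eq ⟨⟨ρ, h.1, rfl⟩, ?_⟩
  rintro _ ⟨τ, hτ, rfl⟩
  exact h.2 hτ i

theorem mem_posetDescents {p : Fin n × Fin n} :
    p ∈ posetDescents Q ↔ Covers Q p.1 p.2 ∧ (p.2 : ℕ) < (p.1 : ℕ) := by
  classical
  rw [posetDescents, Finset.mem_filter]
  simp

/-- The descents of the poset of a tree are the right edges of the tree. -/
theorem IsTreePoset.map_posetDescents (h : IsTreePoset Q T) :
    (posetDescents Q).val.map (fun p => inorderDepth T p.2) = rightMultiset T := by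
  have hcov := h.covers_iff
  have hT := h.1
  subst hT
  have hinj : Set.InjOn (fun p : Fin T.numNodes × Fin T.numNodes => (p.2 : ℕ))
      (posetDescents Q : Set (Fin T.numNodes × Fin T.numNodes)) := by
    -- A vertex has at most one right child: two would be separated by some `k` as shallow as `j`,
    -- and then `j` and `k` by a vertex shallower than `j`, contradicting domination.
    have aux : ∀ i i' j : Fin T.numNodes, (j : ℕ) < i → (i : ℕ) < i' →
        Dominates (inorderDepth T) i j ∧ inorderDepth T i = inorderDepth T j + 1 →
        Dominates (inorderDepth T) i' j ∧ inorderDepth T i' = inorderDepth T j + 1 → False := by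
      rintro i i' j h1 h2 ⟨hd, he⟩ ⟨hd', he'⟩
      obtain ⟨k, hk1, hk2, hk3⟩ := exists_inorderDepth_lt_between T h2 i'.2 (by omega)
      have h4 := hd' k (by grind) (by grind)
      obtain ⟨m, hm1, hm2, hm3⟩ := exists_inorderDepth_lt_between T (h1.trans hk1)
        (hk2.trans i'.2) (by omega)
      have := hd' m (by grind) (by grind)
      omega
    rintro ⟨i, j⟩ hp ⟨i', j'⟩ hp' he
    have hj : j = j' := Fin.ext he
    subst hj
    rw [Finset.mem_coe, mem_posetDescents, hcov] at hp hp'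
    rcases lt_trichotomy (i : ℕ) i' with hlt | heq | hlt
    · exact (aux i i' j hp.2 hlt hp.1 hp'.1).elim
    · rw [Fin.ext heq]
    · exact (aux i' i j hp'.2 hlt hp'.1 hp.1).elim
  have himg : (posetDescents Q).image (fun p => (p.2 : ℕ)) =
      (Finset.range T.numNodes).filter fun j =>
        j + 1 < T.numNodes ∧ inorderDepth T j < inorderDepth T (j + 1) := by
    ext j
    simp only [Finset.mem_image, mem_posetDescents, hcov, Finset.mem_filter, Finset.mem_range]
    constructor
    · rintro ⟨⟨i, j⟩, ⟨⟨hd, he⟩, hlt⟩, rfl⟩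
      simp only at hd he hlt ⊢
      have hj : (j : ℕ) + 1 < T.numNodes := by omega
      refine ⟨j.2, hj, lt_of_le_of_ne (hd _ (by grind) (by grind)) fun heq => ?_⟩
      obtain ⟨k, hk1, hk2, _⟩ := exists_inorderDepth_lt_between T (Nat.lt_succ_self j) hj heq
      omega
    · rintro ⟨hj, hj1, hlt⟩
      -- At an ascent, the right child of `j` is the ancestor of `j + 1` one level below `j`.
      obtain ⟨i, hi, hd, he⟩ := exists_ancestor T hj1 (d := inorderDepth T j + 1) hlt
      have hij : j < i := by
        by_contra hle
        have := hd j (by grind) (by grind)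
        omega
      refine ⟨⟨⟨i, hi⟩, ⟨j, hj⟩⟩, ⟨⟨fun k hk1 hk2 => ?_, he⟩, hij⟩, rfl⟩
      simp only at hk1 hk2 ⊢
      by_cases hk : k = j
      · rw [hk]
      · have := hd k (by grind) (by grind)
        omega
  rw [rightMultiset_eq, ← Finset.range_val, ← Finset.filter_val, ← himg,
    Finset.image_val_of_injOn hinj, Multiset.map_map]
  rfl

theorem IsTreePoset.posetDes_eq (h : IsTreePoset Q T) : posetDes Q = rightNumber T := by
  rw [rightNumber, ← h.map_posetDescents, Multiset.card_map]
  rfl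

theorem IsTreePoset.posetMaj_eq (h : IsTreePoset Q T) (hn : 0 < n) :
    posetMaj Q = rindex T := by
  rw [posetMaj, minRank_eq_of_isLeast (h.isLeast_rank hn), rindex, rightNumber,
    ← h.map_posetDescents, Multiset.card_map]
  -- Adding the depths back turns each truncated difference into the constant `depth T`.
  refine Nat.eq_sub_of_add_eq ?_
  rw [show ((posetDescents Q).val.map fun p => inorderDepth T p.2).sum =
    ∑ p ∈ posetDescents Q, inorderDepth T p.2 from rfl, ← Finset.sum_add_distrib,
    Finset.sum_congr rfl (g := fun _ => depth T) fun p _ => Nat.sub_add_cancel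
      (inorderDepth_le_depth T (h.1 ▸ p.2.2)), Finset.sum_const, smul_eq_mul, mul_comm]
  rfl

end TreePoset

/-! ### The Narayana numbers -/

section Narayana

/-- The Narayana polynomial: binary trees on `n` vertices by the number of right edges. -/
def narayanaPoly (n : ℕ) : ℤ[X] := ∑ T ∈ BinaryTree.treesOfNumNodesEq n, X ^ rightNumber T

theorem narayanaPoly_zero : narayanaPoly 0 = 1 := by
  simp [narayanaPoly, rightNumber, rightMultiset]

theorem rightNumber_node (a : Unit) (l r : BinaryTree Unit) :
    rightNumber (.node a l r) =
      (if r = .nil then 0 else 1) + (rightNumber l + rightNumber r) := by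
  rw [rightNumber, rightMultiset]
  split_ifs <;> simp [rightNumber, add_comm 1]

theorem narayanaPoly_succ (n : ℕ) :
    narayanaPoly (n + 1) = ∑ p ∈ Finset.HasAntidiagonal.antidiagonal n, narayanaPoly p.1 *
      if p.2 = 0 then 1 else X * narayanaPoly p.2 := by
  rw [narayanaPoly, BinaryTree.treesOfNumNodesEq_succ, Finset.sum_biUnion]
  · refine Finset.sum_congr rfl fun p _ => ?_
    rw [Finset.sum_map, Finset.sum_product, narayanaPoly, Finset.sum_mul]
    refine Finset.sum_congr rfl fun l _ => ?_
    split_ifs with hp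
    · rw [hp, BinaryTree.treesOfNumNodesEq_zero, Finset.sum_singleton, mul_one]
      change X ^ rightNumber (.node () l .nil) = _
      rw [rightNumber_node, if_pos rfl, zero_add]
      simp [rightNumber, rightMultiset]
    · rw [narayanaPoly, Finset.mul_sum, Finset.mul_sum]
      refine Finset.sum_congr rfl fun r hr => ?_
      have hne : r ≠ .nil := by
        rintro rfl
        exact hp (by simpa using (BinaryTree.mem_treesOfNumNodesEq.1 hr).symm)
      change X ^ rightNumber (.node () l r) = _
      rw [rightNumber_node, if_neg hne]
      ring
  · intro p _ q _ hpq
    rw [Function.onFun, Finset.disjoint_left]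
    rintro T hT hT'
    simp only [Finset.mem_map, Finset.mem_product, BinaryTree.mem_treesOfNumNodesEq] at hT hT'
    obtain ⟨⟨l, r⟩, ⟨h1, h2⟩, rfl⟩ := hT
    obtain ⟨⟨l', r'⟩, ⟨h3, h4⟩, h5⟩ := hT'
    cases h5
    exact hpq (Prod.ext (h1.symm.trans h3) (h2.symm.trans h4))

/-- The generating function of the Narayana polynomials without its constant term. -/
def narayanaSeries : PowerSeries ℤ[X] :=
  PowerSeries.mk fun n => if n = 0 then 0 else narayanaPoly n

/-- Splitting at the root: either subtree may be empty, and a nonempty right one costs one right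
edge, hence a factor `X`. -/
theorem narayanaSeries_eq :
    narayanaSeries = PowerSeries.X *
      ((1 + narayanaSeries) * (1 + PowerSeries.C (X : ℤ[X]) * narayanaSeries)) := by
  ext1 n
  rcases n with _ | n
  · rw [PowerSeries.coeff_zero_X_mul]
    simp [narayanaSeries]
  · rw [PowerSeries.coeff_succ_X_mul, narayanaSeries, PowerSeries.coeff_mk, if_neg (by omega),
      narayanaPoly_succ, PowerSeries.coeff_mul]
    refine Finset.sum_congr rfl fun p _ => ?_
    congr 1
    · rw [map_add, PowerSeries.coeff_one, PowerSeries.coeff_mk]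
      split_ifs with h
      · rw [h, narayanaPoly_zero, add_zero]
      · rw [zero_add]
    · rw [map_add, PowerSeries.coeff_one, PowerSeries.coeff_C_mul, PowerSeries.coeff_mk]
      split_ifs with h
      · rw [mul_zero, add_zero]
      · rw [zero_add]

/-- The integers `C(n,k) C(n,m+k-1) - C(n,k-1) C(n,m+k)`, with the convention that `C(n,-1) = 0`. -/
def ballotMinor (n m k : ℕ) : ℤ :=
  n.choose k * (if m + k = 0 then 0 else n.choose (m + k - 1)) -
    (if k = 0 then 0 else n.choose (k - 1)) * n.choose (m + k)

theorem ballotMinor_zero_middle (n k : ℕ) : ballotMinor n 0 k = 0 := by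
  rcases k with _ | k
  · simp [ballotMinor]
  · simp [ballotMinor]
    ring

theorem ballotMinor_succ_zero (n m : ℕ) :
    ballotMinor (n + 1) (m + 1) 0 = ballotMinor n m 0 + ballotMinor n (m + 1) 0 := by
  rcases m with _ | m
  · simp [ballotMinor]
  · simp [ballotMinor, Nat.choose_succ_succ]

theorem ballotMinor_succ_succ (n m k : ℕ) :
    ballotMinor (n + 1) (m + 1) (k + 1) = ballotMinor n m (k + 1) + ballotMinor n (m + 1) (k + 1) +
      ballotMinor n (m + 1) k + ballotMinor n (m + 2) k := by
  rcases k with _ | k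
  · simp [ballotMinor, Nat.choose_succ_succ]
    ring
  · simp only [ballotMinor, show m + 1 + (k + 1 + 1) = m + k + 1 + 1 + 1 by omega,
      show m + (k + 1 + 1) = m + k + 1 + 1 by omega, show m + 1 + (k + 1) = m + k + 1 + 1 by omega,
      show m + 2 + (k + 1) = m + k + 1 + 1 + 1 by omega,
      Nat.add_sub_cancel, Nat.choose_succ_succ, Nat.succ_ne_zero, if_false]
    push_cast
    ring

/-- All powers are treated at once because the functional equation expresses the coefficients of one
power through those of its neighbours; the minors satisfy the same recursion and vanish at `m = 0`.
-/
theorem coeff_narayanaSeries_pow (n m k : ℕ) :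
    (PowerSeries.coeff (n + 1) (narayanaSeries ^ m)).coeff k = ballotMinor n m k := by
  induction n generalizing m k with
  | zero =>
    rcases m with _ | m
    · rw [ballotMinor_zero_middle, pow_zero, PowerSeries.coeff_one]
      simp
    · have h0 : PowerSeries.constantCoeff narayanaSeries = 0 := by
        rw [narayanaSeries_eq]
        simp
      rw [pow_succ', narayanaSeries_eq, mul_assoc, PowerSeries.coeff_succ_X_mul,
        PowerSeries.coeff_zero_eq_constantCoeff_apply, ← narayanaSeries_eq]
      simp only [map_mul, map_add, map_one, map_pow, h0]
      rcases m with _ | m <;> rcases k with _ | _ | k <;>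
        simp [ballotMinor, Polynomial.coeff_one, Nat.choose_eq_zero_of_lt]
  | succ n ih =>
    rcases m with _ | m
    · rw [ballotMinor_zero_middle, pow_zero, PowerSeries.coeff_one]
      simp
    · have hrec : narayanaSeries ^ (m + 1) = PowerSeries.X * (narayanaSeries ^ m +
          narayanaSeries ^ (m + 1) + PowerSeries.C (X : ℤ[X]) *
            (narayanaSeries ^ (m + 1) + narayanaSeries ^ (m + 2))) := by
        rw [pow_succ' narayanaSeries m]
        nth_rewrite 1 [narayanaSeries_eq]
        ring
      rw [hrec, PowerSeries.coeff_succ_X_mul]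
      simp only [map_add, PowerSeries.coeff_C_mul, Polynomial.coeff_add]
      rcases k with _ | k
      · rw [ih, ih, Polynomial.coeff_X_mul_zero, ballotMinor_succ_zero, add_zero]
      · rw [Polynomial.coeff_X_mul, Polynomial.coeff_add, ih, ih, ih, ih, ballotMinor_succ_succ]
        ring

theorem coeff_narayanaPoly (n k : ℕ) :
    (narayanaPoly (n + 1)).coeff k = ballotMinor n 1 k := by
  rw [← coeff_narayanaSeries_pow, pow_one, narayanaSeries, PowerSeries.coeff_mk,
    if_neg (Nat.succ_ne_zero n)]

theorem eval_one_qNarayana (n k : ℕ) :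
    (qNarayana n (k + 1)).eval 1 = (narayanaPoly n).coeff k := by
  rw [qNarayana, narayanaPoly, Polynomial.eval_finsetSum, Polynomial.finsetSum_coeff,
    Finset.sum_filter]
  refine Finset.sum_congr rfl fun T _ => ?_
  rw [Polynomial.coeff_X_pow]
  by_cases h : rightNumber T = k
  · simp [h]
  · simp [h, Ne.symm h]

theorem ballotMinor_one_mul (n k : ℕ) :
    (n + 1) * ballotMinor n 1 k = (n + 1).choose (k + 1) * (n + 1).choose k := by
  rcases k with _ | k
  · simp [ballotMinor]
  · have h1 : (n + 1 : ℤ) * n.choose (k + 1) = (n + 1).choose (k + 2) * (k + 2) := by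
      exact_mod_cast Nat.add_one_mul_choose_eq n (k + 1)
    have h2 : (n + 1 : ℤ) * n.choose k = (n + 1).choose (k + 1) * (k + 1) := by
      exact_mod_cast Nat.add_one_mul_choose_eq n k
    have h3 : ((n + 1).choose (k + 1) : ℤ) = n.choose k + n.choose (k + 1) := by
      exact_mod_cast Nat.choose_succ_succ n k
    have h4 : ((n + 1).choose (k + 2) : ℤ) = n.choose (k + 1) + n.choose (k + 2) := by
      exact_mod_cast Nat.choose_succ_succ n (k + 1)
    have h5 : (n + 1 : ℤ) * n.choose (k + 1) = (n + 1).choose (k + 1) * (n - k) := by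
      linear_combination -(n + 1 : ℤ) * h3 - h2
    have h6 : (n + 1 : ℤ) * n.choose (k + 2) = (n + 1).choose (k + 2) * (n - k - 1) := by
      linear_combination -(n + 1 : ℤ) * h4 - h1
    simp only [ballotMinor, show 1 + (k + 1) = k + 2 by omega, Nat.add_sub_cancel,
      Nat.succ_ne_zero, if_false, show k + 2 - 1 = k + 1 by omega]
    -- The second factor `n + 1` moves both binomials of each product to row `n + 1`; then
    -- `(n-k)(k+2) - (k+1)(n-k-1) = n+1`.
    refine mul_left_cancel₀ (show (n + 1 : ℤ) ≠ 0 by positivity) ?_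
    linear_combination (n + 1 : ℤ) * n.choose (k + 1) * h5 + (n + 1).choose (k + 1) * (n - k) * h1
      - (n + 1 : ℤ) * n.choose (k + 2) * h2 - (n + 1).choose (k + 1) * (k + 1) * h6

end Narayana

/-! ### Grouping trees by right number, and the main theorem -/

theorem rightNumber_lt (T : BinaryTree Unit) (h : 0 < T.numNodes) :
    rightNumber T < T.numNodes := by
  induction T with
  | nil => simp at h
  | node a l r hl hr =>
    have h0 : rightNumber .nil = 0 := by simp [rightNumber, rightMultiset]
    rw [rightNumber_node, BinaryTree.numNodes]
    have hl' : rightNumber l ≤ l.numNodes := by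
      rcases Nat.eq_zero_or_pos l.numNodes with hz | hz
      · cases l with
        | nil => simp [h0]
        | node => simp at hz
      · exact (hl hz).le
    split_ifs with hr'
    · subst hr'
      rw [h0]
      omega
    · have := hr (by
        cases r with
        | nil => exact absurd rfl hr'
        | node => simp)
      omega

theorem sum_treesOfNumNodesEq_eq_sum_qNarayana (n : ℕ) (hn : 1 ≤ n) :
    ∑ T ∈ BinaryTree.treesOfNumNodesEq n, X ^ rightNumber T * C (X ^ rindex T : ℤ[X]) =
      ∑ k ∈ Finset.Icc 1 n, C (qNarayana n k) * X ^ (k - 1) := by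
  classical
  rw [← Finset.sum_fiberwise_of_maps_to (t := Finset.Icc 1 n) (g := fun T => rightNumber T + 1)]
  · refine Finset.sum_congr rfl fun k _ => ?_
    rw [qNarayana, map_sum, Finset.sum_mul]
    refine Finset.sum_congr rfl fun T hT => ?_
    rw [← (Finset.mem_filter.1 hT).2, Nat.add_sub_cancel, mul_comm]
  · intro T hT
    rw [BinaryTree.mem_treesOfNumNodesEq] at hT
    subst hT
    exact Finset.mem_Icc.2 ⟨by omega, rightNumber_lt T hn⟩

end QAssoc

end

theorem mainTheorem7 (n : ℕ) (hn : 1 ≤ n) (y : Finset (Fin n) → ℝ)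
    (hy : ∀ I ∈ QAssoc.graphBuildingSet (SimpleGraph.pathGraph n), 0 < y I)
    (P : Set (Fin n → ℝ))
    (hP : P = QAssoc.graphAssociahedron (SimpleGraph.pathGraph n) y) :
    -- the sum defining the polynomial is finite, and its major indices are well defined
    (QAssoc.fullCones P).Finite ∧
    (∀ σ : QAssoc.fullCones P,
      IsLeast {ρ | QAssoc.IsRankFunction (QAssoc.fanPoset P σ) ρ}
        (QAssoc.minRank (QAssoc.fanPoset P σ))) ∧
    -- the formula
    QAssoc.qhPolynomial P =
      ∑ T ∈ BinaryTree.treesOfNumNodesEq n,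
        X ^ QAssoc.rightNumber T * C (X ^ QAssoc.rindex T) ∧
    -- the resulting refinement of the Narayana numbers
    QAssoc.qhPolynomial P = ∑ k ∈ Finset.Icc 1 n, C (QAssoc.qNarayana n k) * X ^ (k - 1) ∧
    ∀ k ∈ Finset.Icc 1 n,
      (((QAssoc.qNarayana n k).eval 1 : ℤ) : ℚ) =
        1 / (n : ℚ) * (n.choose k : ℚ) * (n.choose (k - 1) : ℚ) := by
  subst hP
  have htree : ∀ T, QAssoc.IsTreePoset (QAssoc.fanPoset _ (QAssoc.treeConeEquiv hn hy T)) T.1 :=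
    fun T => ⟨BinaryTree.mem_treesOfNumNodesEq.1 T.2, QAssoc.fanPoset_treeConeEquiv_le hn hy T⟩
  have hformula : QAssoc.qhPolynomial (QAssoc.graphAssociahedron (SimpleGraph.pathGraph n) y) =
      ∑ T ∈ BinaryTree.treesOfNumNodesEq n,
        X ^ QAssoc.rightNumber T * C (X ^ QAssoc.rindex T) := by
    refine (finsum_comp_equiv (QAssoc.treeConeEquiv hn hy)).symm.trans ?_
    rw [finsum_eq_sum_of_fintype,
      ← Finset.sum_coe_sort (BinaryTree.treesOfNumNodesEq n)]
    refine Finset.sum_congr rfl fun T _ => ?_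
    rw [(htree T).posetDes_eq, (htree T).posetMaj_eq hn]
  refine ⟨?_, fun σ => ?_, hformula,
    hformula.trans (QAssoc.sum_treesOfNumNodesEq_eq_sum_qNarayana n hn), fun k hk => ?_⟩
  · exact Set.finite_coe_iff.1 (Finite.of_equiv _ (QAssoc.treeConeEquiv hn hy))
  · obtain ⟨T, rfl⟩ := (QAssoc.treeConeEquiv hn hy).surjective σ
    have h := (htree T).isLeast_rank hn
    rwa [QAssoc.minRank_eq_of_isLeast h]
  · obtain ⟨n, rfl⟩ := Nat.exists_eq_add_of_le' hn
    obtain ⟨k, rfl⟩ := Nat.exists_eq_add_of_le' (Finset.mem_Icc.1 hk).1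
    rw [QAssoc.eval_one_qNarayana, QAssoc.coeff_narayanaPoly, Nat.add_sub_cancel]
    have h := congrArg (Int.cast : ℤ → ℚ) (QAssoc.ballotMinor_one_mul n k)
    push_cast at h ⊢
    have hne : (n : ℚ) + 1 ≠ 0 := by positivity
    field_simp
    linarith
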